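/- Let $\triangle=\{(x,y)\in\mathbb R^2: 0<y<x<1\}$ and let $$V=\begin{pmatrix}1&1&1\\0&1&1\\0&0&1\end{pmatrix},\quad A_0=\begin{pmatrix}0&0&1\\1&0&0\\0&1&1\end{pmatrix},\quad A_1=\begin{pmatrix}1&0&1\\0&1&0\\0&0&1\end{pmatrix}.$$ For $(\sigma,\tau_0,\tau_1)\in S_3^3$ put $F_0=\sigma A_0\tau_0$ and $F_1=\sigma A_1\tau_1$, where a permutation $\pi$ is identified with the $3\times3$ matrix whose $i$-th row has its entry $1$ in column $\pi(i)$. For $k\ge 0$ let $\triangle_k$ be the open triangle of all $(x,y)$ such that $(1,x,y)^{T}$ is a linear combination with positive coefficients of the columns of $VF_1^kF_0$; these triangles are pairwise disjoint. The triangle partition (TRIP) map $T=T_{\sigma,\tau_0,\tau_1}$ is defined on $\bigcup_k\triangle_k$ by $$T(x,y)=\left(\frac{w_2}{w_1},\frac{w_3}{w_1}\right),\qquad (w_1,w_2,w_3)^{T}=V\,(VF_1^kF_0)^{-1}(1,x,y)^{T}\qquad\text{for }(x,y)\in\triangle_k ,$$ (points in no $\triangle_k$ are sent to $(0,0)\notin\triangle$).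 The expansion of $(x,y)$ is the sequence $(a_1,a_2,\dots)$ of non-negative integers with $T^{i-1}(x,y)\in\triangle_{a_i}$ for all $i\ge1$, if it exists. Let $(\sigma,\tau_0,\tau_1)$ and $r$ be one of the following ($123$ denotes the cycle $1\mapsto2\mapsto3\mapsto1$, and $132$ its inverse): - $r=\dfrac{12}{\pi^2x(y+1)}$ for $(e,e,e)$; - $r=\dfrac{6}{\pi^2x(1-y)}$ for $(e,23,e)$, $(e,132,e)$, $(13,23,13)$, $(13,132,13)$; - $r=\dfrac{12}{\pi^2(y+1)(-x+y+1)}$ for $(12,12,12)$; - $r=\dfrac{6}{\pi^2(1-y)(-x+y+1)}$ for $(12,13,12)$, $(12,123,12)$, $(123,13,132)$, $(123,123,132)$; - $r=\dfrac{12}{\pi^2(2-x)(1-y)}$ for $(13,13,13)$; - $r=\dfrac{6}{\pi^2x(-x+y+1)}$ for $(23,e,23)$, $(23,12,23)$, $(132,e,123)$, $(132,12,123)$; - $r=\dfrac{12}{\pi^2x(x-y+1)}$ for $(23,23,23)$; - $r=\dfrac{12}{\pi^2(1-y)(x-y+1)}$ for $(123,132,132)$; - $r=\dfrac{12}{\pi^2(2-x)(-x+y+1)}$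 for $(132,123,123)$. Let $\lambda$ be Lebesgue measure on $\triangle$ and $\mu(A)=\int_{A\cap\triangle} r\,dx\,dy$. Suppose that $T$ is ergodic with respect to $\lambda$ (every measurable set $A$ with $T^{-1}A=A$ satisfies $\lambda(A)=0$ or $\lambda(A^{c})=0$) and that $\mu$ is $T$-invariant. Then $\mu$ is a probability measure, and $\lambda$-almost every $(x,y)\in\triangle$ has an expansion $(a_1,a_2,\dots)$ and satisfies, for every integer $k\ge0$, $$\lim_{n\to\infty}\frac{\#\{i: 1\le i\le n,\ a_i=k\}}{n}=\mu(\triangle_k)=\int_{\triangle_k} r\,dx\,dy .$$ -/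

import Mathlib

open MeasureTheory Filter Topology
open scoped Matrix

noncomputable section

namespace TRIP

/-- The open triangle with vertices `(0,0)`, `(1,0)`, `(1,1)`. -/
def triangle : Set (ℝ × ℝ) := {p | 0 < p.2 ∧ p.2 < p.1 ∧ p.1 < 1}

/-- The columns are the homogeneous coordinates of the vertices of the triangle. -/
def V : Matrix (Fin 3) (Fin 3) ℝ := !![1, 1, 1; 0, 1, 1; 0, 0, 1]

/-- `(v₁ v₂ v₃) * A₀ = (v₂ v₃ v₁+v₃)`. -/
def A₀ : Matrix (Fin 3) (Fin 3) ℝ := !![0, 0, 1; 1, 0, 0; 0, 1, 1]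

/-- `(v₁ v₂ v₃) * A₁ = (v₁ v₂ v₁+v₃)`. -/
def A₁ : Matrix (Fin 3) (Fin 3) ℝ := !![1, 0, 1; 0, 1, 0; 0, 0, 1]

/-- `F₀ = σ A₀ τ₀`, where a permutation `π` acts by the matrix whose row `i` has its entry `1`
in column `π i`. -/
def F₀ (σ τ₀ : Equiv.Perm (Fin 3)) : Matrix (Fin 3) (Fin 3) ℝ :=
  σ.permMatrix ℝ * A₀ * τ₀.permMatrix ℝ

/-- `F₁ = σ A₁ τ₁`. -/
def F₁ (σ τ₁ : Equiv.Perm (Fin 3)) : Matrix (Fin 3) (Fin 3) ℝ :=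
  σ.permMatrix ℝ * A₁ * τ₁.permMatrix ℝ

/-- The matrix `V F₁ᵏ F₀`, whose columns are homogeneous coordinates of the vertices of the
`k`-th subtriangle. -/
def cellMatrix (σ τ₀ τ₁ : Equiv.Perm (Fin 3)) (k : ℕ) : Matrix (Fin 3) (Fin 3) ℝ :=
  V * F₁ σ τ₁ ^ k * F₀ σ τ₀

/-- The vector `(1, x, y)`. -/
def homog (p : ℝ × ℝ) : Fin 3 → ℝ := ![1, p.1, p.2]

/-- The projection `(a, b, c) ↦ (b / a, c / a)`. -/
def proj (v : Fin 3 → ℝ) : ℝ × ℝ := (v 1 / v 0, v 2 / v 0)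

/-- The open subtriangle `△ₖ`: the points `(x, y)` for which `(1, x, y)` is a combination with
positive coefficients of the columns of `V F₁ᵏ F₀`. -/
def cell (σ τ₀ τ₁ : Equiv.Perm (Fin 3)) (k : ℕ) : Set (ℝ × ℝ) :=
  {p | ∃ c : Fin 3 → ℝ, (∀ i, 0 < c i) ∧ cellMatrix σ τ₀ τ₁ k *ᵥ c = homog p}

/-- The `k`-th branch: the projective map carrying the columns of `V F₁ᵏ F₀` to the columns
of `V`. -/
def branch (σ τ₀ τ₁ : Equiv.Perm (Fin 3)) (k : ℕ) (p : ℝ × ℝ) : ℝ × ℝ :=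
  proj ((V * (cellMatrix σ τ₀ τ₁ k)⁻¹) *ᵥ homog p)

open Classical in
/-- The triangle partition map. It is given by the `k`-th branch on `△ₖ` (these open triangles
are pairwise disjoint); points lying in no `△ₖ` are sent to the vertex `(0, 0)`, which lies
outside the open triangle. -/
def T (σ τ₀ τ₁ : Equiv.Perm (Fin 3)) (p : ℝ × ℝ) : ℝ × ℝ :=
  if h : ∃ k, p ∈ cell σ τ₀ τ₁ k then branch σ τ₀ τ₁ (Nat.find h) p else 0

/-- `a` is the expansion of `p`: the `i`-th iterate of `p` lies in `△` with index `a i`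
(digits are numbered from `0`). -/
def IsExpansion (σ τ₀ τ₁ : Equiv.Perm (Fin 3)) (p : ℝ × ℝ) (a : ℕ → ℕ) : Prop :=
  ∀ i, (T σ τ₀ τ₁)^[i] p ∈ cell σ τ₀ τ₁ (a i)

/-- The proportion of the digit `k` among the first `n` digits of `a`. -/
def digitFreq (a : ℕ → ℕ) (k n : ℕ) : ℝ :=
  (((Finset.range n).filter fun i => a i = k).card : ℝ) / n

/-- The transposition `(12)`. -/
def p12 : Equiv.Perm (Fin 3) := Equiv.swap 0 1
/-- The transposition `(13)`. -/
def p13 : Equiv.Perm (Fin 3) := Equiv.swap 0 2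
/-- The transposition `(23)`. -/
def p23 : Equiv.Perm (Fin 3) := Equiv.swap 1 2
/-- The cycle `1 ↦ 2 ↦ 3 ↦ 1`. -/
def p123 : Equiv.Perm (Fin 3) := c[0, 1, 2]
/-- The cycle `1 ↦ 3 ↦ 2 ↦ 1`. -/
def p132 : Equiv.Perm (Fin 3) := c[0, 2, 1]

/-- The table of permutation triples `(σ, τ₀, τ₁)` and densities. -/
inductive TableDensity :
    Equiv.Perm (Fin 3) → Equiv.Perm (Fin 3) → Equiv.Perm (Fin 3) → (ℝ × ℝ → ℝ) → Prop
  | r01 : TableDensity 1 1 1 fun p => 12 / (Real.pi ^ 2 * (p.1 * (p.2 + 1)))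
  | r02 : TableDensity 1 p23 1 fun p => 6 / (Real.pi ^ 2 * (p.1 * (1 - p.2)))
  | r03 : TableDensity 1 p132 1 fun p => 6 / (Real.pi ^ 2 * (p.1 * (1 - p.2)))
  | r04 : TableDensity p12 p12 p12 fun p => 12 / (Real.pi ^ 2 * ((p.2 + 1) * (-p.1 + p.2 + 1)))
  | r05 : TableDensity p12 p13 p12 fun p => 6 / (Real.pi ^ 2 * ((1 - p.2) * (-p.1 + p.2 + 1)))
  | r06 : TableDensity p12 p123 p12 fun p => 6 / (Real.pi ^ 2 * ((1 - p.2) * (-p.1 + p.2 + 1)))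
  | r07 : TableDensity p13 p13 p13 fun p => 12 / (Real.pi ^ 2 * ((2 - p.1) * (1 - p.2)))
  | r08 : TableDensity p13 p23 p13 fun p => 6 / (Real.pi ^ 2 * (p.1 * (1 - p.2)))
  | r09 : TableDensity p13 p132 p13 fun p => 6 / (Real.pi ^ 2 * (p.1 * (1 - p.2)))
  | r10 : TableDensity p23 1 p23 fun p => 6 / (Real.pi ^ 2 * (p.1 * (-p.1 + p.2 + 1)))
  | r11 : TableDensity p23 p12 p23 fun p => 6 / (Real.pi ^ 2 * (p.1 * (-p.1 + p.2 + 1)))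
  | r12 : TableDensity p23 p23 p23 fun p => 12 / (Real.pi ^ 2 * (p.1 * (p.1 - p.2 + 1)))
  | r13 : TableDensity p123 p13 p132
      fun p => 6 / (Real.pi ^ 2 * ((1 - p.2) * (-p.1 + p.2 + 1)))
  | r14 : TableDensity p123 p123 p132
      fun p => 6 / (Real.pi ^ 2 * ((1 - p.2) * (-p.1 + p.2 + 1)))
  | r15 : TableDensity p123 p132 p132
      fun p => 12 / (Real.pi ^ 2 * ((1 - p.2) * (p.1 - p.2 + 1)))
  | r16 : TableDensity p132 1 p123 fun p => 6 / (Real.pi ^ 2 * (p.1 * (-p.1 + p.2 + 1)))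
  | r17 : TableDensity p132 p12 p123 fun p => 6 / (Real.pi ^ 2 * (p.1 * (-p.1 + p.2 + 1)))
  | r18 : TableDensity p132 p123 p123
      fun p => 12 / (Real.pi ^ 2 * ((2 - p.1) * (-p.1 + p.2 + 1)))

/-- Lebesgue measure on the triangle. -/
def leb : Measure (ℝ × ℝ) := volume.restrict triangle

/-- The measure on the triangle with density `r` with respect to Lebesgue measure. -/
def densityMeasure (r : ℝ × ℝ → ℝ) : Measure (ℝ × ℝ) :=
  leb.withDensity fun p => ENNReal.ofReal (r p)

end TRIP

end

/-! The digit `k` occurs at place `i` exactly when the `i`-th iterate lies in the cell of index `k`,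
so digit frequencies are Birkhoff averages of the indicator of that cell, and the claim is
Birkhoff's theorem for the density measure.

Three inputs are needed. The pointwise ergodic theorem is proved from a maximal-function argument
(`Ergodic.ae_mem_birkhoffBounded`). The cells are disjoint, because `F₀` and `F₁` send the positive
cone to opposite sides of a plane. The total mass is `1`: affine symmetries of the triangle reduce
every density to `1/(x(1-y))` or `1/(x(1+y))`, whose integrals come from `ζ(2)`.

The densities are positive on the triangle, so the density measure and Lebesgue measure have the
same null sets; this transfers ergodicity one way and the conclusion back. -/

namespace MeasureTheory

/-! ### Birkhoff's ergodic theorem -/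

variable {α : Type*} {T : α → α} {f : α → ℝ}

/-- The maximum of the Birkhoff sums of `f` of length at most `n`, defined by recursion. -/
noncomputable def maxBirkhoffSum (T : α → α) (f : α → ℝ) : ℕ → α → ℝ
  | 0, _ => 0
  | n + 1, x => max 0 (f x + maxBirkhoffSum T f n (T x))

lemma maxBirkhoffSum_succ (n : ℕ) (x : α) :
    maxBirkhoffSum T f (n + 1) x = max 0 (f x + maxBirkhoffSum T f n (T x)) := rfl

lemma maxBirkhoffSum_nonneg (n : ℕ) (x : α) : 0 ≤ maxBirkhoffSum T f n x := by
  cases n with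
  | zero => exact le_rfl
  | succ n => exact le_max_left _ _

lemma birkhoffSum_le_maxBirkhoffSum (n : ℕ) (x : α) :
    birkhoffSum T f n x ≤ maxBirkhoffSum T f n x := by
  induction n generalizing x with
  | zero => simp [maxBirkhoffSum]
  | succ n ih =>
    rw [birkhoffSum_succ', maxBirkhoffSum_succ]
    exact le_max_of_le_right (by linarith [ih (T x)])

lemma maxBirkhoffSum_le_succ (n : ℕ) (x : α) :
    maxBirkhoffSum T f n x ≤ maxBirkhoffSum T f (n + 1) x := by
  induction n generalizing x with
  | zero => exact maxBirkhoffSum_nonneg 1 x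
  | succ n ih =>
    rw [maxBirkhoffSum_succ, maxBirkhoffSum_succ]
    exact max_le_max le_rfl (by linarith [ih (T x)])

lemma monotone_maxBirkhoffSum (x : α) : Monotone fun n => maxBirkhoffSum T f n x :=
  monotone_nat_of_le_succ fun n => maxBirkhoffSum_le_succ n x

/-- The points at which the Birkhoff sums of `f` are bounded above. -/
def birkhoffBounded (T : α → α) (f : α → ℝ) : Set α :=
  {x | ∃ C : ℕ, ∀ n, maxBirkhoffSum T f n x ≤ C}

/-- Sums started at `x` and at `T x` differ by the single term `f x`, which does not affect
boundedness. -/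
lemma preimage_birkhoffBounded : T ⁻¹' birkhoffBounded T f = birkhoffBounded T f := by
  ext x
  constructor
  · rintro ⟨C, hC⟩
    obtain ⟨D, hD⟩ := exists_nat_ge (|f x| + C)
    refine ⟨D, fun n => (maxBirkhoffSum_le_succ n x).trans ?_⟩
    rw [maxBirkhoffSum_succ]
    exact max_le D.cast_nonneg (by linarith [hC n, le_abs_self (f x)])
  · rintro ⟨C, hC⟩
    obtain ⟨D, hD⟩ := exists_nat_ge (|f x| + C)
    refine ⟨D, fun n => ?_⟩
    have h := (le_max_right _ _).trans (hC (n + 1))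
    linarith [neg_abs_le (f x)]

variable [MeasurableSpace α] {μ : Measure α}

lemma measurable_maxBirkhoffSum (hT : Measurable T) (hf : Measurable f) (n : ℕ) :
    Measurable (maxBirkhoffSum T f n) := by
  induction n with
  | zero => exact measurable_const
  | succ n ih => exact measurable_const.max (hf.add (ih.comp hT))

lemma measurableSet_birkhoffBounded (hT : Measurable T) (hf : Measurable f) :
    MeasurableSet (birkhoffBounded T f) := by
  simp only [birkhoffBounded, Set.ofPred_exists, Set.ofPred_forall]
  exact .iUnion fun C => .iInter fun n =>
    measurableSet_le (measurable_maxBirkhoffSum hT hf n) measurable_const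

lemma integrable_maxBirkhoffSum (hT : MeasurePreserving T μ μ) (hf : Integrable f μ) (n : ℕ) :
    Integrable (maxBirkhoffSum T f n) μ := by
  induction n with
  | zero => exact integrable_zero _ _ _
  | succ n ih =>
    exact (integrable_zero _ _ _).sup (hf.add (hT.integrable_comp_of_integrable ih))

/-- If the integral of `f` is negative, the Birkhoff sums of `f` along an ergodic map are almost
everywhere bounded above. -/
lemma _root_.Ergodic.ae_mem_birkhoffBounded (hT : Ergodic T μ) (hfm : Measurable f)
    (hf : Integrable f μ) (hneg : ∫ x, f x ∂μ < 0) : ∀ᵐ x ∂μ, x ∈ birkhoffBounded T f := by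
  have hmp := hT.toMeasurePreserving
  rcases (hT.toPreErgodic.ae_empty_or_univ
    (measurableSet_birkhoffBounded hT.measurable hfm) preimage_birkhoffBounded) with h | h
  swap
  · exact eventuallyEq_univ.mp h
  exfalso
  -- Write `Mₙ` for the maximal sums. If they are almost everywhere unbounded, `Mₙ₊₁ - Mₙ ∘ T = max
  -- (-Mₙ ∘ T) f` tends to `f`, dominated by `|f|`. By invariance its integral is `∫ (Mₙ₊₁ - Mₙ) ≥
  -- 0`, contradicting `∫ f < 0`.
  have hunb : ∀ᵐ x ∂μ, x ∉ birkhoffBounded T f := eventuallyEq_empty.mp h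
  have hcomp : ∀ n, Integrable (fun x => maxBirkhoffSum T f n (T x)) μ := fun n =>
    hmp.integrable_comp_of_integrable (integrable_maxBirkhoffSum hmp hf n)
  have hint : ∀ n, ∫ x, maxBirkhoffSum T f n (T x) ∂μ = ∫ x, maxBirkhoffSum T f n x ∂μ :=
    fun n => by
      conv_rhs => rw [← hmp.map_eq]
      exact (integral_map hmp.measurable.aemeasurable
        (measurable_maxBirkhoffSum hT.measurable hfm n).aestronglyMeasurable).symm
  have heq : ∀ n x, maxBirkhoffSum T f (n + 1) x - maxBirkhoffSum T f n (T x)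
      = max (-maxBirkhoffSum T f n (T x)) (f x) := fun n x => by
    rw [maxBirkhoffSum_succ, max_sub_sub_right 0 _ _ |>.symm]
    congr 1 <;> ring
  have hlim : Tendsto (fun n => ∫ x, (maxBirkhoffSum T f (n + 1) x
      - maxBirkhoffSum T f n (T x)) ∂μ) atTop (𝓝 (∫ x, f x ∂μ)) := by
    refine tendsto_integral_of_dominated_convergence (fun x => |f x|)
      (fun n => ((integrable_maxBirkhoffSum hmp hf (n + 1)).sub (hcomp n)).aestronglyMeasurable)
      hf.abs (fun n => .of_forall fun x => ?_) ?_
    · rw [heq, Real.norm_eq_abs, abs_le]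
      exact ⟨(neg_abs_le _).trans (le_max_right _ _), max_le
        ((neg_nonpos.mpr (maxBirkhoffSum_nonneg _ _)).trans (abs_nonneg _)) (le_abs_self _)⟩
    · filter_upwards [hunb] with x hx
      rw [← preimage_birkhoffBounded] at hx
      have htop : Tendsto (fun n => maxBirkhoffSum T f n (T x)) atTop atTop := by
        refine tendsto_atTop_atTop_of_monotone (monotone_maxBirkhoffSum _) fun b => ?_
        by_contra! hb
        obtain ⟨C, hC⟩ := exists_nat_ge b
        exact hx ⟨C, fun n => (hb n).le.trans hC⟩
      refine tendsto_const_nhds.congr' ?_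
      filter_upwards [htop.eventually_ge_atTop (-f x)] with n hn
      rw [heq, max_eq_right (by linarith)]
  refine (hneg.trans_le (ge_of_tendsto' hlim fun n => ?_)).false
  rw [integral_sub (integrable_maxBirkhoffSum hmp hf (n + 1)) (hcomp n), hint, sub_nonneg]
  exact integral_mono (integrable_maxBirkhoffSum hmp hf n)
    (integrable_maxBirkhoffSum hmp hf (n + 1)) (maxBirkhoffSum_le_succ n)

lemma _root_.Ergodic.ae_eventually_birkhoffAverage_lt [IsProbabilityMeasure μ]
    (hT : Ergodic T μ) (hfm : Measurable f) (hf : Integrable f μ) :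
    ∀ᵐ x ∂μ, ∀ c, ∫ y, f y ∂μ < c → ∀ᶠ n in atTop, birkhoffAverage ℝ T f n x < c := by
  -- The function `f - q` has negative integral, so its sums are bounded by some `C` and the
  -- averages of `f` are at most `q + C / n`. Rational `q` keep the exceptional set null.
  have key : ∀ q : ℚ, ∫ y, f y ∂μ < q → ∀ᵐ x ∂μ, x ∈ birkhoffBounded T fun y => f y - q := by
    intro q hq
    refine hT.ae_mem_birkhoffBounded (hfm.sub_const _) (hf.sub (integrable_const _)) ?_
    rw [integral_sub hf (integrable_const _)]
    simpa using hq
  have key' : ∀ᵐ x ∂μ, ∀ q : ℚ, ∫ y, f y ∂μ < q → x ∈ birkhoffBounded T fun y => f y - q :=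
    ae_all_iff.mpr fun q => by
      by_cases hq : ∫ y, f y ∂μ < q
      · filter_upwards [key q hq] with x hx _ using hx
      · exact .of_forall fun x h => absurd h hq
  filter_upwards [key'] with x hx c hc
  obtain ⟨q, hq, hqc⟩ := exists_rat_btwn hc
  obtain ⟨C, hC⟩ := hx q hq
  have hlim : Tendsto (fun n : ℕ => (C : ℝ) / n) atTop (𝓝 0) :=
    tendsto_const_div_atTop_nhds_zero_nat _
  filter_upwards [hlim.eventually_lt_const (sub_pos.mpr hqc), eventually_gt_atTop 0] with n hn hn0
  have hn0' : (0 : ℝ) < n := Nat.cast_pos.mpr hn0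
  have h := (birkhoffSum_le_maxBirkhoffSum n x).trans (hC n)
  rw [birkhoffSum, Finset.sum_sub_distrib, Finset.sum_const, Finset.card_range, nsmul_eq_mul] at h
  rw [div_lt_iff₀ hn0'] at hn
  rw [birkhoffAverage, birkhoffSum, smul_eq_mul, inv_mul_lt_iff₀ hn0']
  linarith

/-- **Birkhoff's pointwise ergodic theorem** for ergodic maps of a probability space. -/
theorem _root_.Ergodic.ae_tendsto_birkhoffAverage [IsProbabilityMeasure μ]
    (hT : Ergodic T μ) (hfm : Measurable f) (hf : Integrable f μ) :
    ∀ᵐ x ∂μ, Tendsto (fun n => birkhoffAverage ℝ T f n x) atTop (𝓝 (∫ y, f y ∂μ)) := by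
  filter_upwards [hT.ae_eventually_birkhoffAverage_lt hfm hf,
    hT.ae_eventually_birkhoffAverage_lt hfm.neg hf.neg] with x h₁ h₂
  refine tendsto_order.mpr ⟨fun c hc => ?_, h₁⟩
  filter_upwards [h₂ (-c) (by simpa [integral_neg] using hc)] with n hn
  rw [birkhoffAverage_neg] at hn
  simpa using hn

end MeasureTheory

namespace TRIP

/-! ### Geometry of the cells -/

variable (σ τ₀ τ₁ : Equiv.Perm (Fin 3))

/-- The open positive orthant. -/
def posCone : Set (Fin 3 → ℝ) := {c | ∀ i, 0 < c i}

lemma det_F₁_ne_zero : (F₁ σ τ₁).det ≠ 0 := by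
  simp [F₁, Matrix.det_permutation, A₁, Matrix.det_fin_three]

lemma det_F₀_ne_zero : (F₀ σ τ₀).det ≠ 0 := by
  simp [F₀, Matrix.det_permutation, A₀, Matrix.det_fin_three]

lemma det_V : V.det = 1 := by
  simp [V, Matrix.det_fin_three]

lemma det_cellMatrix_ne_zero (k : ℕ) : (cellMatrix σ τ₀ τ₁ k).det ≠ 0 := by
  rw [cellMatrix, Matrix.det_mul, Matrix.det_mul, Matrix.det_pow, det_V, one_mul]
  exact mul_ne_zero (pow_ne_zero _ (det_F₁_ne_zero σ τ₁)) (det_F₀_ne_zero σ τ₀)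

lemma permMatrix_mulVec_apply (c : Fin 3 → ℝ) (i : Fin 3) : (σ.permMatrix ℝ *ᵥ c) i = c (σ i) := by
  rw [Matrix.permMatrix_mulVec, Function.comp_apply]

lemma A₀_mulVec (c : Fin 3 → ℝ) : A₀ *ᵥ c = ![c 2, c 0, c 1 + c 2] := by
  ext i; fin_cases i <;> simp [A₀, Matrix.mulVec, dotProduct, Fin.sum_univ_three]

lemma A₁_mulVec (c : Fin 3 → ℝ) : A₁ *ᵥ c = ![c 0 + c 2, c 1, c 2] := by
  ext i; fin_cases i <;> simp [A₁, Matrix.mulVec, dotProduct, Fin.sum_univ_three]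

lemma permMatrix_mulVec_mem_posCone {c : Fin 3 → ℝ} (hc : c ∈ posCone) :
    σ.permMatrix ℝ *ᵥ c ∈ posCone := fun i => by
  rw [permMatrix_mulVec_apply]; exact hc _

lemma F₀_mulVec_mem_posCone {c : Fin 3 → ℝ} (hc : c ∈ posCone) :
    F₀ σ τ₀ *ᵥ c ∈ posCone := by
  rw [F₀, ← Matrix.mulVec_mulVec, ← Matrix.mulVec_mulVec]
  have h := permMatrix_mulVec_mem_posCone τ₀ hc
  refine permMatrix_mulVec_mem_posCone σ fun i => ?_
  rw [A₀_mulVec]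
  fin_cases i
  exacts [h 2, h 0, add_pos (h 1) (h 2)]

lemma F₁_mulVec_mem_posCone {c : Fin 3 → ℝ} (hc : c ∈ posCone) :
    F₁ σ τ₁ *ᵥ c ∈ posCone := by
  rw [F₁, ← Matrix.mulVec_mulVec, ← Matrix.mulVec_mulVec]
  have h := permMatrix_mulVec_mem_posCone τ₁ hc
  refine permMatrix_mulVec_mem_posCone σ fun i => ?_
  rw [A₁_mulVec]
  fin_cases i
  exacts [add_pos (h 0) (h 2), h 1, h 2]

lemma F₁_pow_mulVec_mem_posCone {c : Fin 3 → ℝ} (hc : c ∈ posCone) (k : ℕ) :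
    F₁ σ τ₁ ^ k *ᵥ c ∈ posCone := by
  induction k with
  | zero => simpa using hc
  | succ k ih =>
    rw [pow_succ', ← Matrix.mulVec_mulVec]
    exact F₁_mulVec_mem_posCone σ τ₁ ih

/-- Before the common `σ` is applied, the third coordinate exceeds the first on the image under
`A₀`, and the first exceeds the third on the image under `A₁`. -/
lemma F₀_mulVec_ne_F₁_mulVec {c d : Fin 3 → ℝ} (hc : c ∈ posCone) (hd : d ∈ posCone) :
    F₀ σ τ₀ *ᵥ c ≠ F₁ σ τ₁ *ᵥ d := by
  intro h
  rw [F₀, F₁, ← Matrix.mulVec_mulVec, ← Matrix.mulVec_mulVec, ← Matrix.mulVec_mulVec,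
    ← Matrix.mulVec_mulVec, A₀_mulVec, A₁_mulVec] at h
  have hc' := permMatrix_mulVec_mem_posCone τ₀ hc 1
  have hd' := permMatrix_mulVec_mem_posCone τ₁ hd 0
  have h0 := congrFun h (σ.symm 0)
  have h2 := congrFun h (σ.symm 2)
  simp only [permMatrix_mulVec_apply σ, Equiv.apply_symm_apply, Matrix.cons_val] at h0 h2
  linarith

lemma cell_disjoint_of_lt {k l : ℕ} (hkl : k < l) :
    Disjoint (cell σ τ₀ τ₁ k) (cell σ τ₀ τ₁ l) := by
  rw [Set.disjoint_left]
  rintro p ⟨c, hc, hcp⟩ ⟨d, hd, hdp⟩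
  obtain ⟨m, rfl⟩ := Nat.exists_eq_add_of_lt hkl
  -- With `l = k + m + 1`, cancelling `V F₁ᵏ` leaves `F₀ c = F₁ (F₁ᵐ F₀ d)`.
  have hinj : Function.Injective (V * F₁ σ τ₁ ^ k).mulVec := by
    rw [Matrix.mulVec_injective_iff_isUnit, Matrix.isUnit_iff_isUnit_det, isUnit_iff_ne_zero,
      Matrix.det_mul, Matrix.det_pow, det_V, one_mul]
    exact pow_ne_zero _ (det_F₁_ne_zero σ τ₁)
  have hd' := F₁_pow_mulVec_mem_posCone σ τ₁ (F₀_mulVec_mem_posCone σ τ₀ hd) m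
  refine F₀_mulVec_ne_F₁_mulVec σ τ₀ τ₁ hc hd' (hinj ?_)
  simp only [Matrix.mulVec_mulVec]
  rw [cellMatrix] at hcp hdp
  rw [hcp, ← hdp]
  simp only [pow_add, pow_one, Matrix.mul_assoc]
  rw [← Matrix.mul_assoc (F₁ σ τ₁ ^ m), ← pow_succ, pow_succ', Matrix.mul_assoc]

lemma eq_of_mem_cell {p : ℝ × ℝ} {k l : ℕ} (hk : p ∈ cell σ τ₀ τ₁ k) (hl : p ∈ cell σ τ₀ τ₁ l) :
    k = l := by
  rcases lt_trichotomy k l with h | h | h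
  · exact (Set.disjoint_left.mp (cell_disjoint_of_lt σ τ₀ τ₁ h) hk hl).elim
  · exact h
  · exact (Set.disjoint_left.mp (cell_disjoint_of_lt σ τ₀ τ₁ h) hl hk).elim

lemma cell_eq (k : ℕ) :
    cell σ τ₀ τ₁ k = {p | ∀ i, 0 < ((cellMatrix σ τ₀ τ₁ k)⁻¹ *ᵥ homog p) i} := by
  have hu : IsUnit (cellMatrix σ τ₀ τ₁ k).det :=
    isUnit_iff_ne_zero.mpr (det_cellMatrix_ne_zero σ τ₀ τ₁ k)
  ext p
  constructor
  · rintro ⟨c, hc, hcp⟩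
    simpa [← hcp, Matrix.mulVec_mulVec, Matrix.nonsing_inv_mul _ hu] using hc
  · intro h
    exact ⟨_, h, by rw [Matrix.mulVec_mulVec, Matrix.mul_nonsing_inv _ hu, Matrix.one_mulVec]⟩

lemma measurableSet_cell (k : ℕ) : MeasurableSet (cell σ τ₀ τ₁ k) := by
  rw [cell_eq, Set.ofPred_forall]
  refine .iInter fun i => measurableSet_lt measurable_const ?_
  simp only [Matrix.mulVec, dotProduct, Fin.sum_univ_three, homog, Matrix.cons_val]
  fun_prop

lemma exists_mem_cell_of_T_ne_zero {p : ℝ × ℝ} (h : T σ τ₀ τ₁ p ≠ 0) :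
    ∃ k, p ∈ cell σ τ₀ τ₁ k := by
  by_contra hp
  exact h (dif_neg hp)

end TRIP

namespace TRIP

/-! ### Total mass of the densities -/

lemma measurableSet_triangle : MeasurableSet triangle :=
  (measurableSet_lt measurable_const measurable_snd).inter
    ((measurableSet_lt measurable_snd measurable_fst).inter
      (measurableSet_lt measurable_fst measurable_const))

lemma lintegral_leb_eq {f : ℝ × ℝ → ENNReal} (hf : Measurable f) :
    ∫⁻ p, f p ∂leb = ∫⁻ x in Set.Ioo (0 : ℝ) 1, ∫⁻ y in Set.Ioo 0 x, f (x, y) := by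
  rw [leb, ← lintegral_indicator measurableSet_triangle, Measure.volume_eq_prod,
    lintegral_prod _ (hf.indicator measurableSet_triangle).aemeasurable,
    ← lintegral_indicator measurableSet_Ioo]
  refine lintegral_congr fun x => ?_
  by_cases hx : x ∈ Set.Ioo (0 : ℝ) 1
  · rw [Set.indicator_of_mem hx, ← lintegral_indicator measurableSet_Ioo]
    refine lintegral_congr fun y => ?_
    simp only [Set.indicator_apply, triangle, Set.mem_ofPred_eq, Set.mem_Ioo, hx.2, and_true]
  · rw [Set.indicator_of_notMem hx]
    refine lintegral_eq_zero_of_ae_eq_zero (.of_forall fun y => Set.indicator_of_notMem ?_ _)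
    exact fun h => hx ⟨h.1.trans h.2.1, h.2.2⟩

lemma setLIntegral_Ioo_eq_ofReal {f : ℝ → ℝ} {b : ℝ} (hb : 0 ≤ b)
    (hf : Continuous f) (hpos : ∀ y ∈ Set.Ioo 0 b, 0 ≤ f y) :
    ∫⁻ y in Set.Ioo 0 b, ENNReal.ofReal (f y) = ENNReal.ofReal (∫ y in 0..b, f y) := by
  rw [intervalIntegral.integral_of_le hb, integral_Ioc_eq_integral_Ioo,
    ofReal_integral_eq_lintegral_ofReal]
  · exact (hf.integrableOn_Icc).mono_set Set.Ioo_subset_Icc_self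
  · exact (ae_restrict_iff' measurableSet_Ioo).mpr (.of_forall hpos)

lemma lintegral_leb_pow_div (n : ℕ) :
    ∫⁻ p, ENNReal.ofReal (p.2 ^ n / p.1) ∂leb = ENNReal.ofReal (1 / (n + 1) ^ 2) := by
  rw [lintegral_leb_eq (by fun_prop)]
  have h1 : ∀ x ∈ Set.Ioo (0 : ℝ) 1, ∫⁻ y in Set.Ioo 0 x, ENNReal.ofReal (y ^ n / x)
      = ENNReal.ofReal (x ^ n / (n + 1)) := by
    intro x hx
    have hx0 := hx.1
    rw [setLIntegral_Ioo_eq_ofReal hx0.le (by fun_prop)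
      fun y hy => div_nonneg (pow_nonneg hy.1.le n) hx0.le]
    rw [intervalIntegral.integral_div, integral_pow]
    congr 1
    field_simp
    simp [pow_succ']
  rw [setLIntegral_congr_fun measurableSet_Ioo h1, setLIntegral_Ioo_eq_ofReal zero_le_one
    (by fun_prop) fun y hy => div_nonneg (pow_nonneg hy.1.le n) (by positivity)]
  rw [intervalIntegral.integral_div, integral_pow]
  congr 1
  field_simp
  simp

lemma ae_leb_mem : ∀ᵐ p ∂leb, p ∈ triangle := ae_restrict_mem measurableSet_triangle

lemma lintegral_leb_inv_mul_one_sub :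
    ∫⁻ p, ENNReal.ofReal (1 / (p.1 * (1 - p.2))) ∂leb = ENNReal.ofReal (Real.pi ^ 2 / 6) := by
  have h1 : ∫⁻ p, ENNReal.ofReal (1 / (p.1 * (1 - p.2))) ∂leb
      = ∫⁻ p, ∑' n : ℕ, ENNReal.ofReal (p.2 ^ n / p.1) ∂leb := by
    refine lintegral_congr_ae ?_
    filter_upwards [ae_leb_mem] with p hp
    obtain ⟨h0, h1, h2⟩ := hp
    have hs := (hasSum_geometric_of_lt_one h0.le (h1.trans h2)).div_const p.1
    rw [← ENNReal.ofReal_tsum_of_nonneg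
      (fun n => div_nonneg (pow_nonneg h0.le n) (h0.trans h1).le) hs.summable, hs.tsum_eq]
    congr 1
    field_simp
  -- The index shift drops the term `1 / 0 ^ 2 = 0` of the series for `ζ(2)`.
  have hs := (hasSum_nat_add_iff' 1).mpr hasSum_zeta_two
  rw [h1, lintegral_tsum fun n => by fun_prop]
  simp only [lintegral_leb_pow_div]
  rw [← ENNReal.ofReal_tsum_of_nonneg (fun n => by positivity) (by simpa using hs.summable)]
  congr 1
  simpa using hs.tsum_eq

/-- The integrand is `1/(x(1-y)) - 1/(x(1+y))`, that is, twice the odd part in `y` of the geometric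
series over `x`. Only the terms `1/(2n+2)²` survive, whence the factor `1/4` of `ζ(2)`. -/
lemma lintegral_leb_odd :
    ∫⁻ p, ENNReal.ofReal (2 * p.2 / (p.1 * (1 - p.2 ^ 2))) ∂leb
      = ENNReal.ofReal (Real.pi ^ 2 / 12) := by
  have h1 : ∫⁻ p, ENNReal.ofReal (2 * p.2 / (p.1 * (1 - p.2 ^ 2))) ∂leb
      = ∫⁻ p, ∑' n : ℕ, 2 * ENNReal.ofReal (p.2 ^ (2 * n + 1) / p.1) ∂leb := by
    refine lintegral_congr_ae ?_
    filter_upwards [ae_leb_mem] with p hp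
    obtain ⟨h0, h1, h2⟩ := hp
    have hlt : p.2 ^ 2 < 1 := pow_lt_one₀ h0.le (h1.trans h2) two_ne_zero
    have hs := ((hasSum_geometric_of_lt_one (sq_nonneg p.2) hlt).mul_left p.2).div_const p.1
    have he : ∀ n : ℕ, p.2 ^ (2 * n + 1) / p.1 = p.2 * (p.2 ^ 2) ^ n / p.1 := fun n => by
      rw [pow_succ', pow_mul]
    simp only [he]
    rw [ENNReal.tsum_mul_left, ← ENNReal.ofReal_tsum_of_nonneg
      (fun n => div_nonneg (by positivity) (h0.trans h1).le) hs.summable, hs.tsum_eq,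
      ← ENNReal.ofReal_ofNat, ← ENNReal.ofReal_mul zero_le_two]
    congr 1
    field_simp
  have hs := ((hasSum_nat_add_iff' 1).mpr hasSum_zeta_two).mul_left (1 / 4)
  have hs' : HasSum (fun n : ℕ => 1 / (((2 * n + 1 : ℕ) : ℝ) + 1) ^ 2)
      (1 / 4 * (Real.pi ^ 2 / 6)) := by
    simp only [Finset.sum_range_one, Nat.cast_zero, ne_eq, OfNat.ofNat_ne_zero, not_false_eq_true,
      zero_pow, div_zero, sub_zero] at hs
    refine hs.congr_fun fun n => ?_
    push_cast
    field_simp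
    ring
  rw [h1, lintegral_tsum fun n => by fun_prop]
  simp only [lintegral_const_mul' _ _ ENNReal.ofNat_ne_top, lintegral_leb_pow_div]
  rw [ENNReal.tsum_mul_left, ← ENNReal.ofReal_tsum_of_nonneg (fun n => by positivity) hs'.summable,
    hs'.tsum_eq, ← ENNReal.ofReal_ofNat, ← ENNReal.ofReal_mul zero_le_two]
  congr 1
  ring

lemma lintegral_leb_inv_mul_one_add :
    ∫⁻ p, ENNReal.ofReal (1 / (p.1 * (p.2 + 1))) ∂leb = ENNReal.ofReal (Real.pi ^ 2 / 12) := by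
  have h : ∫⁻ p, ENNReal.ofReal (1 / (p.1 * (p.2 + 1))) ∂leb
      + ∫⁻ p, ENNReal.ofReal (2 * p.2 / (p.1 * (1 - p.2 ^ 2))) ∂leb
      = ∫⁻ p, ENNReal.ofReal (1 / (p.1 * (1 - p.2))) ∂leb := by
    rw [← lintegral_add_left (by fun_prop)]
    refine lintegral_congr_ae ?_
    filter_upwards [ae_leb_mem] with p hp
    obtain ⟨h0, h1, h2⟩ := hp
    have hx := h0.trans h1
    have hy : 0 < 1 - p.2 := sub_pos.mpr (h1.trans h2)
    have hf : 1 - p.2 ^ 2 = (1 - p.2) * (p.2 + 1) := by ring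
    rw [hf, ← ENNReal.ofReal_add (by positivity) (by positivity)]
    congr 1
    field_simp
    ring
  rw [lintegral_leb_odd, lintegral_leb_inv_mul_one_sub] at h
  refine (ENNReal.add_left_inj (ENNReal.ofReal_ne_top (r := Real.pi ^ 2 / 12))).mp ?_
  rw [h, ← ENNReal.ofReal_add (by positivity) (by positivity)]
  congr 1
  ring

/-- A measure preserving map of the plane that maps the triangle and its complement into
themselves preserves the measure `leb`. -/
lemma measurePreserving_leb {φ : ℝ × ℝ → ℝ × ℝ} (h : MeasurePreserving φ volume volume)
    (hφ : ∀ p, φ p ∈ triangle ↔ p ∈ triangle) : MeasurePreserving φ leb leb := by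
  have h' := h.restrict_preimage measurableSet_triangle
  rwa [show φ ⁻¹' triangle = triangle from Set.ext hφ] at h'

/-- This is the affine symmetry exchanging the vertices `(1,0)` and `(1,1)`. Together with
`measurePreserving_flip`, which exchanges `(0,0)` and `(1,1)`, it generates all six symmetries of
the triangle. -/
lemma measurePreserving_shear :
    MeasurePreserving (fun p : ℝ × ℝ => (p.1, p.1 - p.2)) leb leb := by
  refine measurePreserving_leb ((MeasurePreserving.id volume).skew_product
    (g := fun x y => x - y) (by fun_prop)
    (.of_forall fun x => (Measure.measurePreserving_sub_left volume x).map_eq)) fun p => ?_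
  constructor <;> rintro ⟨h0, h1, h2⟩ <;> refine ⟨?_, ?_, h2⟩ <;> simp only at * <;> linarith

lemma measurePreserving_flip :
    MeasurePreserving (fun p : ℝ × ℝ => (1 - p.2, 1 - p.1)) leb leb := by
  refine measurePreserving_leb (((Measure.measurePreserving_sub_left volume (1 : ℝ)).prod
    (Measure.measurePreserving_sub_left volume (1 : ℝ))).comp Measure.measurePreserving_swap)
    fun p => ?_
  constructor <;> rintro ⟨h0, h1, h2⟩ <;> refine ⟨?_, ?_, ?_⟩ <;> simp only at * <;> linarith

lemma lintegral_leb_ofReal_const_div {c : ℝ} {g : ℝ × ℝ → ℝ} (hc : 0 < c)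
    (h : ∫⁻ p, ENNReal.ofReal (1 / g p) ∂leb = ENNReal.ofReal (Real.pi ^ 2 / c)) :
    ∫⁻ p, ENNReal.ofReal (c / (Real.pi ^ 2 * g p)) ∂leb = 1 := by
  have he : ∀ p, ENNReal.ofReal (c / (Real.pi ^ 2 * g p))
      = ENNReal.ofReal (c / Real.pi ^ 2) * ENNReal.ofReal (1 / g p) := fun p => by
    rw [← ENNReal.ofReal_mul (by positivity), div_mul_div_comm, mul_one]
  simp only [he]
  rw [lintegral_const_mul' _ _ ENNReal.ofReal_ne_top, h, ← ENNReal.ofReal_mul (by positivity),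
    div_mul_div_cancel₀ (by positivity), div_self hc.ne', ENNReal.ofReal_one]

lemma lintegral_leb_ofReal_comp {r : ℝ × ℝ → ℝ} (hr : Measurable r)
    (h : ∫⁻ p, ENNReal.ofReal (r p) ∂leb = 1) {φ : ℝ × ℝ → ℝ × ℝ}
    (hφ : MeasurePreserving φ leb leb) : ∫⁻ p, ENNReal.ofReal (r (φ p)) ∂leb = 1 :=
  (hφ.lintegral_comp hr.ennreal_ofReal).trans h

variable {σ τ₀ τ₁ : Equiv.Perm (Fin 3)} {r : ℝ × ℝ → ℝ}

lemma TableDensity.measurable (hr : TableDensity σ τ₀ τ₁ r) : Measurable r := by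
  cases hr <;> fun_prop

lemma TableDensity.pos (hr : TableDensity σ τ₀ τ₁ r) {p : ℝ × ℝ} (hp : p ∈ triangle) :
    0 < r p := by
  obtain ⟨h0, h1, h2⟩ := hp
  have ha : 0 < p.1 := h0.trans h1
  have hb : 0 < 1 - p.2 := by linarith
  have hc : 0 < -p.1 + p.2 + 1 := by linarith
  have hd : 0 < p.1 - p.2 + 1 := by linarith
  have he : 0 < 2 - p.1 := by linarith
  cases hr <;> positivity

lemma TableDensity.lintegral_eq_one (hr : TableDensity σ τ₀ τ₁ r) :
    ∫⁻ p, ENNReal.ofReal (r p) ∂leb = 1 := by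
  have hA := measurePreserving_shear
  have hB := measurePreserving_flip
  have hplus := lintegral_leb_ofReal_const_div (by norm_num) lintegral_leb_inv_mul_one_add
  have hminus := lintegral_leb_ofReal_const_div (by norm_num) lintegral_leb_inv_mul_one_sub
  have plus := fun {φ} => lintegral_leb_ofReal_comp (φ := φ) (by fun_prop) hplus
  have minus := fun {φ} => lintegral_leb_ofReal_comp (φ := φ) (by fun_prop) hminus
  cases hr
  case r01 => exact hplus
  case r02 | r03 | r08 | r09 => exact hminus
  case r04 =>
    convert plus (hA.comp (hB.comp hA)) using 5
    simp only [Function.comp_apply]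
    ring
  case r05 | r06 | r13 | r14 =>
    convert minus (hA.comp (hB.comp hA)) using 5
    simp only [Function.comp_apply]
    ring
  case r07 =>
    convert plus hB using 5
    ring
  case r10 | r11 | r16 | r17 =>
    convert minus hA using 5
    ring
  case r12 =>
    convert plus hA using 5
  case r15 =>
    convert plus (hA.comp hB) using 5
    simp only [Function.comp_apply]
    ring
  case r18 =>
    convert plus (hB.comp hA) using 5
    simp only [Function.comp_apply]
    ring

end TRIP

namespace TRIP

/-! ### Expansions and ergodicity of the density measure -/

variable {σ τ₀ τ₁ : Equiv.Perm (Fin 3)} {r : ℝ × ℝ → ℝ}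

lemma densityMeasure_absolutelyContinuous : densityMeasure r ≪ leb :=
  withDensity_absolutelyContinuous _ _

lemma TableDensity.leb_absolutelyContinuous (hr : TableDensity σ τ₀ τ₁ r) :
    leb ≪ densityMeasure r := by
  refine withDensity_absolutelyContinuous' hr.measurable.ennreal_ofReal.aemeasurable ?_
  filter_upwards [ae_leb_mem] with p hp
  exact (ENNReal.ofReal_pos.mpr (hr.pos hp)).ne'

lemma TableDensity.isProbabilityMeasure (hr : TableDensity σ τ₀ τ₁ r) :
    IsProbabilityMeasure (densityMeasure r) :=
  ⟨by rw [densityMeasure, withDensity_apply _ .univ, Measure.restrict_univ, hr.lintegral_eq_one]⟩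

/-- Almost every orbit of a map that preserves the measure stays in the triangle, and therefore
in the union of the cells. -/
lemma ae_exists_isExpansion
    (hinv : MeasurePreserving (T σ τ₀ τ₁) (densityMeasure r) (densityMeasure r)) :
    ∀ᵐ p ∂densityMeasure r, ∃ a, IsExpansion σ τ₀ τ₁ p a := by
  have htri : ∀ᵐ p ∂densityMeasure r, p ∈ triangle :=
    densityMeasure_absolutelyContinuous.ae_le ae_leb_mem
  filter_upwards [ae_all_iff.mpr fun i => (hinv.iterate i).quasiMeasurePreserving.ae htri] with p hp
  refine Classical.skolem.mp fun i => exists_mem_cell_of_T_ne_zero σ τ₀ τ₁ fun h0 => ?_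
  -- An iterate outside all cells would be sent to `(0, 0)`, which is not in the open triangle.
  have h := hp (i + 1)
  rw [Function.iterate_succ_apply', h0] at h
  exact lt_irrefl _ h.1

/-- Disjointness of the cells makes visiting the cell of index `k` equivalent to having the digit
`k`. -/
lemma IsExpansion.digitFreq_eq {p : ℝ × ℝ} {a : ℕ → ℕ} (ha : IsExpansion σ τ₀ τ₁ p a) (k n : ℕ) :
    digitFreq a k n
      = birkhoffAverage ℝ (T σ τ₀ τ₁) ((cell σ τ₀ τ₁ k).indicator fun _ => (1 : ℝ)) n p := by
  have hiff : ∀ i, a i = k ↔ (T σ τ₀ τ₁)^[i] p ∈ cell σ τ₀ τ₁ k := fun i =>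
    ⟨fun h => h ▸ ha i, fun h => eq_of_mem_cell σ τ₀ τ₁ (ha i) h⟩
  classical
  simp only [digitFreq, birkhoffAverage, birkhoffSum, Set.indicator_apply, ← hiff,
    Finset.sum_boole, smul_eq_mul, div_eq_inv_mul]

lemma ergodic_densityMeasure (herg : PreErgodic (T σ τ₀ τ₁) leb)
    (hinv : MeasurePreserving (T σ τ₀ τ₁) (densityMeasure r) (densityMeasure r)) :
    Ergodic (T σ τ₀ τ₁) (densityMeasure r) where
  toMeasurePreserving := hinv
  aeconst_set _ hs hs' :=
    (herg.aeconst_set hs hs').anti densityMeasure_absolutelyContinuous.ae_le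

end TRIP

theorem mainTheorem6 (σ τ₀ τ₁ : Equiv.Perm (Fin 3)) (r : ℝ × ℝ → ℝ)
    (hr : TRIP.TableDensity σ τ₀ τ₁ r)
    (herg : PreErgodic (TRIP.T σ τ₀ τ₁) TRIP.leb)
    (hinv : MeasurePreserving (TRIP.T σ τ₀ τ₁) (TRIP.densityMeasure r) (TRIP.densityMeasure r)) :
    IsProbabilityMeasure (TRIP.densityMeasure r) ∧
      ∀ᵐ p ∂TRIP.leb,
        (∃ a, TRIP.IsExpansion σ τ₀ τ₁ p a) ∧
          ∀ a, TRIP.IsExpansion σ τ₀ τ₁ p a →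
            ∀ k : ℕ, Tendsto (TRIP.digitFreq a k) atTop
              (𝓝 ((TRIP.densityMeasure r).real (TRIP.cell σ τ₀ τ₁ k))) := by
  have hprob := hr.isProbabilityMeasure
  refine ⟨hprob, hr.leb_absolutelyContinuous.ae_le ?_⟩
  have hbirkhoff := fun k =>
    (TRIP.ergodic_densityMeasure herg hinv).ae_tendsto_birkhoffAverage
      (measurable_const.indicator (TRIP.measurableSet_cell σ τ₀ τ₁ k))
      ((integrable_const (1 : ℝ)).indicator (TRIP.measurableSet_cell σ τ₀ τ₁ k))
  filter_upwards [TRIP.ae_exists_isExpansion hinv, ae_all_iff.mpr hbirkhoff] with p hexp hp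
  refine ⟨hexp, fun a ha k => ?_⟩
  have h := hp k
  rw [integral_indicator_const _ (TRIP.measurableSet_cell σ τ₀ τ₁ k), smul_eq_mul, mul_one] at h
  exact h.congr fun n => (ha.digitFreq_eq k n).symm
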